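/- **Theorem.** Let $H$ be a complex Hilbert space, let $L(H)$ be the Banach algebra of bounded linear operators on $H$ with its norm topology, let $\mathbb{X}$ be a topological space, and let $\mathcal{C}(\mathbb{X},L(H))$ be the algebra of continuous maps $\mathcal{T}:\mathbb{X}\to L(H)$, $x\mapsto\mathcal{T}_x$, with pointwise operations and unit $\mathcal{I}$, $\mathcal{I}_x=I$. Let $\mathcal{T}\in\mathcal{C}(\mathbb{X},L(H))$ be a normal family, that is, $\mathcal{T}_x$ is a normal operator for every $x\in\mathbb{X}$. Then $\mathcal{T}$ satisfies Weyl's theorem, that is, $$\sigma_W(\mathcal{T})=\sigma(\mathcal{T})\setminus E_0(\mathcal{T}).$$ Here: * $\sigma(\mathcal{T})$ is the spectrum of $\mathcal{T}$ in the algebra $\mathcal{C}(\mathbb{X},L(H))$. * A family $\mathcal{S}\in\mathcal{C}(\mathbb{X},L(H))$ is a Fredholm family if every $\mathcal{S}_x$ is a Fredholm operator, i.e. $\dim N(\mathcal{S}_x)<\infty$ and $\operatorname{codim}R(\mathcal{S}_x)<\infty$. The index of a Fredholm operator $S$ is $\operatorname{ind}(S)=\dim N(S)-\operatorname{codim}R(S)$.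 For a Fredholm family $\mathcal{S}$ the number $\operatorname{ind}(\mathcal{S}_x)$ depends only on the connected component $\overline{x}$ of $x$ in $\mathbb{X}$, and the index of $\mathcal{S}$ is the family of integers $\operatorname{ind}(\mathcal{S})=(\operatorname{ind}(\mathcal{S}_x))_{\overline{x}}$ indexed by the connected components of $\mathbb{X}$. A Weyl family is a Fredholm family of index $0$. * $\sigma_W(\mathcal{T})=\{\lambda\in\mathbb{C} : \mathcal{T}-\lambda\mathcal{I}\text{ is not a Weyl family}\}$. * For $T\in L(H)$, $E_0(T)$ is the set of isolated points of $\sigma(T)$ that are eigenvalues of $T$ of finite multiplicity, i.e. $0<\dim N(T-\lambda I)<\infty$. For the family $\mathcal{T}$, $$E_0(\mathcal{T})=\Big\{\lambda\in\sigma(\mathcal{T}) : \exists\,A\subseteq\mathbb{X},\ A\neq\emptyset,\ \lambda\in\bigcap_{x\in A}E_0(\mathcal{T}_x)\ \text{and}\ \lambda\notin\bigcup_{x\in\mathbb{X}\setminus A}\sigma(\mathcal{T}_x)\Big\}.$$ -/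

import Mathlib

open Topology Filter

namespace FredholmFamily

variable {X : Type*} [TopologicalSpace X]
variable {H : Type*} [NormedAddCommGroup H] [InnerProductSpace ℂ H] [CompleteSpace H]

/-- The index `n(T) - d(T)` of an operator, where `n(T) = dim N(T)` and `d(T) = codim R(T)`.
Only used for Fredholm operators. -/
noncomputable def opIndex (T : H →L[ℂ] H) : ℤ :=
  (Module.finrank ℂ T.ker : ℤ) - (Module.finrank ℂ (H ⧸ T.range) : ℤ)

section Helpers

/-- If `S` is injective on `W`, and both `W` and `S(W)` have finite codimension, then
`dim N(S) - codim R(S) = codim W - codim S(W)`. -/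
theorem index_eq_of_disjoint {V : Type*} [AddCommGroup V] [Module ℂ V] (S : V →ₗ[ℂ] V)
    (W : Submodule ℂ V) [FiniteDimensional ℂ (V ⧸ W)] [FiniteDimensional ℂ (V ⧸ W.map S)]
    (hW : Disjoint W (LinearMap.ker S)) :
    (Module.finrank ℂ (LinearMap.ker S) : ℤ) - (Module.finrank ℂ (V ⧸ LinearMap.range S) : ℤ) =
      (Module.finrank ℂ (V ⧸ W) : ℤ) - (Module.finrank ℂ (V ⧸ W.map S) : ℤ) := by
  have hle : W ≤ (W.map S).comap S := Submodule.le_comap_map S W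
  let φ := W.mapQ (W.map S) S hle
  have h1 := φ.finrank_range_add_finrank_ker
  have h2 := Submodule.finrank_quotient_add_finrank (LinearMap.range φ)
  have hker : LinearMap.ker φ = (LinearMap.ker S).map W.mkQ := by
    have : LinearMap.ker φ = ((W.map S).comap S).map W.mkQ := Submodule.ker_mapQ _ _ _ _
    rw [this, Submodule.comap_map_eq, Submodule.map_sup]
    simp
  have hker' : Module.finrank ℂ (LinearMap.ker φ) = Module.finrank ℂ (LinearMap.ker S) := by
    have hinj : Function.Injective (W.mkQ.domRestrict (LinearMap.ker S)) := by
      rw [← LinearMap.ker_eq_bot, LinearMap.ker_domRestrict, Submodule.ker_mkQ,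
        ← Submodule.disjoint_iff_comap_eq_bot]
      exact hW.symm
    have h := (LinearEquiv.ofInjective _ hinj).finrank_eq
    rw [h, hker, LinearMap.range_domRestrict]
  have hran : Module.finrank ℂ ((V ⧸ W.map S) ⧸ LinearMap.range φ) =
      Module.finrank ℂ (V ⧸ LinearMap.range S) := by
    have h : LinearMap.range φ = (LinearMap.range S).map (W.map S).mkQ :=
      Submodule.range_mapQ _ _ _ _
    rw [h]
    exact (Submodule.quotientQuotientEquivQuotient (W.map S) (LinearMap.range S)
      (LinearMap.map_le_range)).finrank_eq
  omega

/-- An operator with finite nullity and finite defect becomes invertible after restricting it to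
the orthogonal complement of its kernel and adding a complement of its range. -/
theorem exists_equiv (T : H →L[ℂ] H) (_ : FiniteDimensional ℂ T.ker)
    (_ : FiniteDimensional ℂ (H ⧸ T.range)) :
    ∃ G : Submodule ℂ H, FiniteDimensional ℂ G ∧ ∃ e : ((T.ker)ᗮ × G) ≃L[ℂ] H,
      (e : ((T.ker)ᗮ × G) →L[ℂ] H) = (T ∘L (T.ker)ᗮ.subtypeL).coprod G.subtypeL := by
  obtain ⟨G, hG⟩ := Submodule.exists_isCompl T.range
  have hfin : FiniteDimensional ℂ G :=
    LinearEquiv.finiteDimensional (Submodule.quotientEquivOfIsCompl _ _ hG)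
  have hc : IsCompl T.ker (T.ker)ᗮ := Submodule.isCompl_orthogonal _
  have hker : (T ∘L (T.ker)ᗮ.subtypeL).ker = ⊥ := by
    refine (Submodule.eq_bot_iff _).2 fun x hx => ?_
    have hx' : (x : H) ∈ T.ker := by simpa using hx
    have := Submodule.disjoint_def.1 hc.disjoint x hx' x.2
    exact Subtype.ext this
  have hran : (T ∘L (T.ker)ᗮ.subtypeL).range = T.range := by
    apply le_antisymm
    · rintro _ ⟨x, rfl⟩
      exact ⟨x, rfl⟩
    · rintro _ ⟨x, rfl⟩
      have hx : x ∈ T.ker ⊔ (T.ker)ᗮ := by rw [hc.sup_eq_top]; trivial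
      obtain ⟨y, hy, z, hz, rfl⟩ := Submodule.mem_sup.1 hx
      refine ⟨⟨z, hz⟩, ?_⟩
      have hy' : T y = 0 := hy
      simp [hy']
  rw [← hran] at hG
  exact ⟨G, hfin, ContinuousLinearMap.coprodSubtypeLEquivOfIsCompl _ hG hker, rfl⟩

/-- On a Hilbert space, an operator is Fredholm if and only if its nullity and its defect are
finite. -/
theorem isFredholm_iff (T : H →L[ℂ] H) :
    T.IsFredholm ↔ FiniteDimensional ℂ T.ker ∧ FiniteDimensional ℂ (H ⧸ T.range) := by
  refine ⟨fun h => ⟨h.finite_ker, h.finite_coker⟩, fun ⟨h₁, h₂⟩ => ?_⟩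
  obtain ⟨G, hG, e, he⟩ := exists_equiv T h₁ h₂
  have hc : IsCompl (T.ker)ᗮ T.ker := (Submodule.isCompl_orthogonal T.ker).symm
  have hco : (T.ker)ᗮ.CoFG :=
    LinearEquiv.finiteDimensional (Submodule.quotientEquivOfIsCompl _ _ hc).symm
  have hcr : T.range.CoFG := h₂
  let v : H →L[ℂ] H := (T.ker)ᗮ.subtypeL ∘L ContinuousLinearMap.fst ℂ _ _ ∘L
    (e.symm : H →L[ℂ] ((T.ker)ᗮ × G))
  have hv : ∀ w : H, w ∈ (T.ker)ᗮ → v (T w) = w := fun w hw => by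
    have h : e (⟨w, hw⟩, 0) = T w := by
      have := congrArg (fun f : ((T.ker)ᗮ × G) →L[ℂ] H => f (⟨w, hw⟩, 0)) he
      simpa using this
    simp [v, ← h]
  have hl : ∀ x : H, T (v (T x)) = T x := fun x => by
    have hx : x ∈ (T.ker)ᗮ ⊔ T.ker := by rw [hc.sup_eq_top]; trivial
    obtain ⟨y, hy, z, hz, rfl⟩ := Submodule.mem_sup.1 hx
    have hz' : T z = 0 := hz
    rw [map_add, hz', add_zero, hv y hy]
  refine ContinuousLinearMap.IsFredholm.of_isQuasiInverse (v := v) ⟨?_, ?_⟩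
  · exact LinearMap.FiniteRangeSetoid.equiv_of_eqOn_coFG hco fun w hw => hv w hw
  · refine LinearMap.FiniteRangeSetoid.equiv_of_eqOn_coFG hcr ?_
    rintro _ ⟨x, rfl⟩
    exact hl x

/-- The index is constant near an operator with finite nullity and finite defect. -/
theorem eventually_opIndex_eq (T : H →L[ℂ] H) (h₁ : FiniteDimensional ℂ T.ker)
    (h₂ : FiniteDimensional ℂ (H ⧸ T.range)) : ∀ᶠ S in 𝓝 T, opIndex S = opIndex T := by
  obtain ⟨G, hG, e, he⟩ := exists_equiv T h₁ h₂
  let W := (T.ker)ᗮ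
  have hc : IsCompl W T.ker :=
    (Submodule.isCompl_orthogonal T.ker).symm
  have hVW : FiniteDimensional ℂ (H ⧸ W) :=
    LinearEquiv.finiteDimensional (Submodule.quotientEquivOfIsCompl _ _ hc).symm
  have key : ∀ S : H →L[ℂ] H, (∃ e' : (W × G) ≃L[ℂ] H,
      (e' : (W × G) →L[ℂ] H) = (S ∘L W.subtypeL).coprod G.subtypeL) →
      opIndex S = (Module.finrank ℂ (H ⧸ W) : ℤ) - (Module.finrank ℂ G : ℤ) := by
    rintro S ⟨e', he'⟩
    have hval : ∀ p : W × G, e' p = S p.1 + p.2 := fun p => by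
      have := congrArg (fun f : (W × G) →L[ℂ] H => f p) he'
      simpa using this
    have hdis : Disjoint W S.ker := by
      rw [Submodule.disjoint_def]
      intro x hx hx'
      have h0 : e' (⟨x, hx⟩, 0) = 0 := by
        rw [hval]; simpa using hx'
      have := e'.map_eq_zero_iff.1 h0
      simpa using this
    have hcompl : IsCompl (W.map (S : H →ₗ[ℂ] H)) G := by
      constructor
      · rw [Submodule.disjoint_def]
        rintro _ ⟨x, hx, rfl⟩ hg
        have h0 : e' (⟨x, hx⟩, -⟨S x, hg⟩) = 0 := by
          rw [hval]; simp
        have := e'.map_eq_zero_iff.1 h0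
        have h3 : x = 0 := by simpa using congrArg (fun p : W × G => (p.1 : H)) this
        simp [h3]
      · rw [codisjoint_iff, eq_top_iff]
        rintro y -
        have := hval (e'.symm y)
        rw [e'.apply_symm_apply] at this
        rw [this]
        exact Submodule.add_mem_sup ⟨_, (e'.symm y).1.2, rfl⟩ (e'.symm y).2.2
    let q := Submodule.quotientEquivOfIsCompl _ _ hcompl
    have : FiniteDimensional ℂ (H ⧸ W.map (S : H →ₗ[ℂ] H)) := LinearEquiv.finiteDimensional q.symm
    have h := index_eq_of_disjoint (S : H →ₗ[ℂ] H) W hdis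
    rw [q.finrank_eq] at h
    exact h
  have hcont : Continuous fun S : H →L[ℂ] H => (S ∘L W.subtypeL).coprod G.subtypeL := by
    fun_prop
  have hnhds := e.nhds
  rw [show (e : (W × G) →L[ℂ] H) = (T ∘L W.subtypeL).coprod G.subtypeL from he] at hnhds
  filter_upwards [hcont.continuousAt.preimage_mem_nhds hnhds] with S hS
  obtain ⟨e', he'⟩ := hS
  rw [key S ⟨e', he'⟩, key T ⟨e, he⟩]

end Helpers

/-- A continuous family `T : X → L(H)` is a Fredholm family if every `T x` is Fredholm. -/
def IsFredholmFamily (T : C(X, H →L[ℂ] H)) : Prop :=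
  ∀ x, (T x).IsFredholm

/-- The index of the members of a Fredholm family is constant on connected components. -/
theorem IsFredholmFamily.opIndex_eq {T : C(X, H →L[ℂ] H)} (hT : IsFredholmFamily T) (x y : X)
    (hxy : connectedComponent x = connectedComponent y) : opIndex (T x) = opIndex (T y) := by
  have hloc : IsLocallyConstant fun x => opIndex (T x) := by
    rw [IsLocallyConstant.iff_eventually_eq]
    intro x
    exact T.continuous.continuousAt.eventually
      (eventually_opIndex_eq (T x) (hT x).finite_ker (hT x).finite_coker)
  exact hloc.apply_eq_of_isPreconnected isPreconnected_connectedComponent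
    mem_connectedComponent (hxy ▸ mem_connectedComponent)

/-- The index of a continuous Fredholm family: the family of integers, indexed by the connected
components of `X`, whose entry at the component of `x` is the index of `T x`. -/
noncomputable def familyIndex (T : C(X, H →L[ℂ] H)) (hT : IsFredholmFamily T) :
    ConnectedComponents X → ℤ :=
  Quotient.lift (fun x => opIndex (T x)) fun x y h => hT.opIndex_eq x y h

/-- A Weyl family is a Fredholm family of index `0`. -/
def IsWeylFamily (T : C(X, H →L[ℂ] H)) : Prop :=
  ∃ hT : IsFredholmFamily T, familyIndex T hT = 0

/-- The Weyl spectrum of a family: all `μ` such that `T - μ I` is not a Weyl family. -/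
def weylSpectrum (T : C(X, H →L[ℂ] H)) : Set ℂ :=
  {μ | ¬ IsWeylFamily (T - algebraMap ℂ C(X, H →L[ℂ] H) μ)}

/-- `E₀` of a single operator: the isolated points of the spectrum which are eigenvalues of finite
multiplicity. -/
def opE₀ (T : H →L[ℂ] H) : Set ℂ :=
  {μ | μ ∈ spectrum ℂ T ∧ ¬ AccPt μ (𝓟 (spectrum ℂ T)) ∧
    Module.End.HasEigenvalue (T : Module.End ℂ H) μ ∧
    FiniteDimensional ℂ (Module.End.eigenspace (T : Module.End ℂ H) μ)}

/-- `E₀` of a family: the points `μ` of the spectrum of `T` (in the algebra of all continuous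
families) for which there is a nonempty `A ⊆ X` such that `μ ∈ E₀(T x)` for all `x ∈ A`, and
`μ ∉ σ(T x)` for all `x ∉ A`. -/
def familyE₀ (T : C(X, H →L[ℂ] H)) : Set ℂ :=
  {μ | μ ∈ spectrum ℂ T ∧ ∃ A : Set X, A.Nonempty ∧
    μ ∈ ⋂ x ∈ A, opE₀ (T x) ∧ μ ∉ ⋃ x ∈ Aᶜ, spectrum ℂ (T x)}

/-- A family is normal if all its members are normal operators. -/
def IsNormalFamily (T : C(X, H →L[ℂ] H)) : Prop :=
  ∀ x, IsStarNormal (T x)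

/-- `T` satisfies Weyl's theorem if `σ_W(T) = σ(T) \ E₀(T)`. -/
def SatisfiesWeylTheorem (T : C(X, H →L[ℂ] H)) : Prop :=
  weylSpectrum T = spectrum ℂ T \ familyE₀ T

end FredholmFamily

namespace FredholmFamily

variable {X : Type*} [TopologicalSpace X]
variable {H : Type*} [NormedAddCommGroup H] [InnerProductSpace ℂ H] [CompleteSpace H]

/-! A normal operator `S` satisfies `ran(S)ᗮ = ker S`, so when its range is closed `H = ker S ⊕ ran
S`. A normal Fredholm operator therefore has index `0`, and for normal families Weyl means Fredholm.

The rest is pointwise: `T x - μ` is Fredholm iff `μ` is outside `σ(T x)` or lies in `E₀(T x)`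
(`isFredholm_sub_iff`). If it is Fredholm, the splitting isolates `0` in its spectrum
(`eventually_isUnit_sub`); conversely, at an isolated point the continuous functional calculus
yields a generalized inverse (`exists_mul_mul_eq`). As `σ(T)` is the union of the `σ(T x)`, both
sides of Weyl's theorem say that `μ ∈ σ(T x) \ E₀(T x)` for some `x`. -/

/-! ### Normal Fredholm operators -/

/-- The kernel and the range of a normal operator with closed range are complementary. -/
theorem isCompl_ker_range {S : H →L[ℂ] H} (hS : IsStarNormal S)
    (hcl : IsClosed (S.range : Set H)) : IsCompl S.ker S.range := by
  have : CompleteSpace S.range := hcl.completeSpace_coe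
  have h := Submodule.isCompl_orthogonal S.range
  rw [ContinuousLinearMap.IsStarNormal.orthogonal_range hS] at h
  exact h.symm

/-- The kernel is a complement of the closed range, so its dimension is the codimension of the
range. -/
theorem opIndex_eq_zero {S : H →L[ℂ] H} (hS : IsStarNormal S) (hF : S.IsFredholm) :
    opIndex S = 0 := by
  rw [opIndex, (Submodule.quotientEquivOfIsCompl _ _
    (isCompl_ker_range hS hF.isClosed_range).symm).finrank_eq, sub_self]

/-- An operator of index `0` with trivial kernel is invertible. -/
theorem isUnit_of_ker_eq_bot {S : H →L[ℂ] H} (hF : S.IsFredholm) (hi : opIndex S = 0)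
    (hk : S.ker = ⊥) : IsUnit S := by
  have := hF.finite_coker
  rw [opIndex, hk, finrank_bot, Nat.cast_zero, zero_sub, neg_eq_zero, Nat.cast_eq_zero,
    Module.finrank_zero_iff, Submodule.Quotient.subsingleton_iff] at hi
  exact ContinuousLinearMap.isUnit_iff_bijective.2
    ⟨LinearMap.ker_eq_bot.1 hk, LinearMap.range_eq_top.1 hi⟩

/-- If `p` is an idempotent with `S p = p S = 0` and `S + p - c` is invertible, where `c ≠ 0`, then
`S - c` is invertible. -/
theorem isUnit_sub_algebraMap {A : Type*} [Ring A] [Algebra ℂ A] {S p : A} (hp : p * p = p)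
    (hSp : S * p = 0) (hpS : p * S = 0) {c : ℂ} (hc : c ≠ 0)
    (hu : IsUnit (S + p - algebraMap ℂ A c)) : IsUnit (S - algebraMap ℂ A c) := by
  obtain ⟨u, hu⟩ := hu
  have hcomm : Commute p (u : A) := by
    rw [hu]
    refine Commute.sub_right (Commute.add_right ?_ rfl) (Algebra.commute_algebraMap_right c p)
    rw [Commute, SemiconjBy, hSp, hpS]
  have h₁ : S - algebraMap ℂ A c = u - p := by rw [hu]; abel
  have hv : Commute p (↑u⁻¹ : A) := hcomm.units_inv_right
  have hcc : algebraMap ℂ A c * algebraMap ℂ A c⁻¹ = 1 := by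
    rw [← map_mul, mul_inv_cancel₀ hc, map_one]
  have hcp : (S - algebraMap ℂ A c) * p = -(algebraMap ℂ A c * p) := by
    rw [sub_mul, hSp, zero_sub]
  have hcp' : p * algebraMap ℂ A c⁻¹ = algebraMap ℂ A c⁻¹ * p :=
    (Algebra.commute_algebraMap_right c⁻¹ p).eq
  have hr₁ : ((u : A) - p) * (↑u⁻¹ * (1 - p)) = 1 - p := by
    rw [sub_mul, Units.mul_inv_cancel_left, ← mul_assoc p, hv.eq, mul_assoc, mul_sub p, mul_one,
      hp, sub_self, mul_zero, sub_zero]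
  have hr₂ : (S - algebraMap ℂ A c) * (p * algebraMap ℂ A c⁻¹) = -p := by
    rw [← mul_assoc, hcp, neg_mul, mul_assoc, hcp', ← mul_assoc, hcc, one_mul]
  -- The candidate inverse is glued from two pieces: `S - c` acts as `u` on the range of `1 - p` and
  -- as `-c` on the range of `p`.
  have hr : (S - algebraMap ℂ A c) * (↑u⁻¹ * (1 - p) - p * algebraMap ℂ A c⁻¹) = 1 := by
    rw [mul_sub, hr₂, h₁, hr₁, sub_neg_eq_add, sub_add_cancel]
  have hcomm' : Commute (S - algebraMap ℂ A c) (↑u⁻¹ * (1 - p) - p * algebraMap ℂ A c⁻¹) := by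
    rw [h₁]
    have e₁ : Commute ((u : A) - p) (↑u⁻¹ : A) :=
      Commute.sub_left (Commute.refl (u : A)).units_inv_right hv
    have e₂ : Commute ((u : A) - p) p := Commute.sub_left hcomm.symm rfl
    exact (e₁.mul_right ((Commute.one_right _).sub_right e₂)).sub_right
      (e₂.mul_right (Algebra.commute_algebraMap_right _ _))
  exact ⟨⟨_, _, hr, hcomm'.eq ▸ hr⟩, rfl⟩

/-- For a normal Fredholm operator, `0` is not an accumulation point of the spectrum. -/
theorem eventually_isUnit_sub {S : H →L[ℂ] H} (hS : IsStarNormal S) (hF : S.IsFredholm) :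
    ∀ᶠ c in 𝓝 (0 : ℂ), c ≠ 0 → IsUnit (S - algebraMap ℂ (H →L[ℂ] H) c) := by
  have := hF.finite_ker
  have hcompl := isCompl_ker_range hS hF.isClosed_range
  have hperp := ContinuousLinearMap.IsStarNormal.orthogonal_range hS
  -- Adding the orthogonal projection onto the kernel makes `S` invertible, and invertibility is
  -- stable under small scalar shifts.
  let p : H →L[ℂ] H := S.ker.starProjection
  have hpker : ∀ x, p x ∈ S.ker := fun x => S.ker.starProjection_apply_mem x
  have hpid : ∀ x ∈ S.ker, p x = x := fun x hx =>
    Submodule.starProjection_eq_self_iff.2 hx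
  have hp : p * p = p := ContinuousLinearMap.ext fun x => hpid _ (hpker x)
  have hSp : S * p = 0 := ContinuousLinearMap.ext fun x => hpker x
  have hpS : p * S = 0 := by
    refine ContinuousLinearMap.ext fun x => ?_
    refine (Submodule.starProjection_apply_eq_zero_iff _).2 ?_
    rw [← hperp]
    exact Submodule.le_orthogonal_orthogonal _ ⟨x, rfl⟩
  have hunit : IsUnit (S + p) := by
    have happ : ∀ x, p (S x) = 0 := fun x => DFunLike.congr_fun hpS x
    have happ' : ∀ x, S (p x) = 0 := fun x => DFunLike.congr_fun hSp x
    refine ContinuousLinearMap.isUnit_iff_bijective.2 ⟨?_, fun y => ?_⟩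
    · refine (injective_iff_map_eq_zero _).2 fun x hx => ?_
      have hx' : S x + p x = 0 := hx
      have h0 : p x = 0 := by
        have := congrArg p hx'
        rwa [map_add, happ, zero_add, hpid _ (hpker x), map_zero] at this
      rw [h0, add_zero] at hx'
      rw [← hpid x hx', h0]
    · have hy : y ∈ S.ker ⊔ S.range := by rw [hcompl.sup_eq_top]; trivial
      obtain ⟨k, hk, _, ⟨z, rfl⟩, rfl⟩ := Submodule.mem_sup.1 hy
      have hk' : S k = 0 := hk
      -- `S` kills `k` and `p z`, while `p` fixes `k` and kills `z - p z`.
      refine ⟨k + (z - p z), ?_⟩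
      change S (k + (z - p z)) + p (k + (z - p z)) = k + S z
      simp only [map_add, map_sub, hk', happ', hpid _ (hpker z), hpid k hk]
      abel
  have hcont : Continuous fun c : ℂ => S + p - algebraMap ℂ (H →L[ℂ] H) c := by fun_prop
  have hnhds : {A : H →L[ℂ] H | IsUnit A} ∈ 𝓝 (S + p - algebraMap ℂ (H →L[ℂ] H) 0) := by
    rw [map_zero, sub_zero]
    exact Units.isOpen.mem_nhds hunit
  filter_upwards [hcont.continuousAt.preimage_mem_nhds hnhds] with c hc hc0
  exact isUnit_sub_algebraMap hp hSp hpS hc0 hc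

theorem isStarNormal_sub_algebraMap {T : H →L[ℂ] H} (hT : IsStarNormal T) (μ : ℂ) :
    IsStarNormal (T - algebraMap ℂ (H →L[ℂ] H) μ) := by
  refine ⟨?_⟩
  rw [star_sub, ← algebraMap_star_comm]
  exact (hT.star_comm_self.sub_right (Algebra.commute_algebraMap_right _ _)).sub_left
    (Algebra.commute_algebraMap_left _ _)

theorem notMem_spectrum_iff_isUnit_sub {A : Type*} [Ring A] [Algebra ℂ A] (a : A) (μ : ℂ) :
    μ ∉ spectrum ℂ a ↔ IsUnit (a - algebraMap ℂ A μ) := by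
  rw [spectrum.notMem_iff, IsUnit.sub_iff]

/-! ### Isolated points of the spectrum -/

/-- If `μ` is an isolated point of the spectrum of a normal operator `T`, then `S = T - μ` has a
generalized inverse `R` with `S S R = S`. -/
theorem exists_mul_mul_eq {T : H →L[ℂ] H} (hT : IsStarNormal T) {μ : ℂ}
    (hμ : ¬ AccPt μ (𝓟 (spectrum ℂ T))) :
    ∃ R : H →L[ℂ] H, (T - algebraMap ℂ (H →L[ℂ] H) μ) *
      ((T - algebraMap ℂ (H →L[ℂ] H) μ) * R) = T - algebraMap ℂ (H →L[ℂ] H) μ := by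
  -- With the convention `0⁻¹ = 0`, `g μ = 0`. The jump at `μ` is harmless: `μ` is not an
  -- accumulation point, so `g` is continuous on the spectrum.
  let g : ℂ → ℂ := fun z => (z - μ)⁻¹
  have hg : ContinuousOn g (spectrum ℂ T) := by
    intro z hz
    by_cases h : z = μ
    · subst h
      rw [accPt_principal_iff_nhdsWithin, not_neBot] at hμ
      refine continuousWithinAt_sdiff_self.1 ?_
      rw [ContinuousWithinAt, hμ]
      exact tendsto_bot
    · exact ((continuousAt_id.sub continuousAt_const).inv₀
        (sub_ne_zero.2 h)).continuousWithinAt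
  have hs : cfc (fun z : ℂ => z - μ) T = T - algebraMap ℂ (H →L[ℂ] H) μ := by
    rw [cfc_sub (fun z : ℂ => z) (fun _ => μ) T, cfc_id' ℂ T, cfc_const μ T]
  refine ⟨cfc g T, ?_⟩
  rw [← hs, ← cfc_mul (fun z : ℂ => z - μ) g T, ← cfc_mul (fun z : ℂ => z - μ) _ T
    (by fun_prop) (by fun_prop)]
  refine cfc_congr fun z _ => ?_
  by_cases h : z - μ = 0
  · simp [h]
  · simp [g, h]

theorem ker_sub_algebraMap (T : H →L[ℂ] H) (μ : ℂ) :
    (T - algebraMap ℂ (H →L[ℂ] H) μ).ker =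
      Module.End.eigenspace (T : Module.End ℂ H) μ := by
  ext x
  rw [Module.End.mem_eigenspace_iff]
  change T x - μ • x = 0 ↔ T x = μ • x
  exact sub_eq_zero

/-- From `S S R = S`, each `z - S (R z)` lies in `ker S`, so the finite-dimensional kernel maps onto
`H / ran S`. -/
theorem isFredholm_sub_of_mem_opE₀ {T : H →L[ℂ] H} (hT : IsStarNormal T) {μ : ℂ}
    (hμ : μ ∈ opE₀ T) : (T - algebraMap ℂ (H →L[ℂ] H) μ).IsFredholm := by
  obtain ⟨-, hiso, -, hfin⟩ := hμ
  obtain ⟨R, hR⟩ := exists_mul_mul_eq hT hiso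
  rw [← ker_sub_algebraMap] at hfin
  generalize T - algebraMap ℂ (H →L[ℂ] H) μ = S at hR hfin ⊢
  refine (isFredholm_iff S).2 ⟨hfin, ?_⟩
  refine Module.Finite.of_surjective (S.range.mkQ ∘ₗ S.ker.subtype) fun y => ?_
  obtain ⟨z, rfl⟩ := S.range.mkQ_surjective y
  have hR' : ∀ w, S (S (R w)) = S w := fun w => DFunLike.congr_fun hR w
  refine ⟨⟨z - S (R z), ?_⟩, ?_⟩
  · change S (z - S (R z)) = 0
    rw [map_sub, hR', sub_self]
  · have : S.range.mkQ (S (R z)) = 0 :=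
      (Submodule.Quotient.mk_eq_zero _).2 ⟨R z, rfl⟩
    simp only [LinearMap.comp_apply, Submodule.subtype_apply, map_sub, this, sub_zero]

/-- `μ` is isolated by `eventually_isUnit_sub`; it is an eigenvalue because index `0` with trivial
kernel would make `T - μ` invertible. -/
theorem mem_opE₀_of_isFredholm_sub {T : H →L[ℂ] H} (hT : IsStarNormal T) {μ : ℂ}
    (hF : (T - algebraMap ℂ (H →L[ℂ] H) μ).IsFredholm) (hμ : μ ∈ spectrum ℂ T) :
    μ ∈ opE₀ T := by
  have hS := isStarNormal_sub_algebraMap hT μ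
  refine ⟨hμ, ?_, ?_, ?_⟩
  · rw [accPt_iff_frequently, not_frequently]
    have htend : Tendsto (fun z : ℂ => z - μ) (𝓝 μ) (𝓝 0) := by
      simpa using (continuous_sub_right μ).tendsto μ
    filter_upwards [htend.eventually (eventually_isUnit_sub hS hF)] with z hz
    rintro ⟨hne, hmem⟩
    have h := hz (sub_ne_zero.2 hne)
    rw [sub_sub, ← map_add, add_sub_cancel, ← notMem_spectrum_iff_isUnit_sub] at h
    exact h hmem
  · rw [Module.End.hasEigenvalue_iff, ← ker_sub_algebraMap]
    intro hk
    exact (notMem_spectrum_iff_isUnit_sub T μ).2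
      (isUnit_of_ker_eq_bot hF (opIndex_eq_zero hS hF) hk) hμ
  · rw [← ker_sub_algebraMap]
    exact hF.finite_ker

theorem isFredholm_sub_iff {T : H →L[ℂ] H} (hT : IsStarNormal T) (μ : ℂ) :
    (T - algebraMap ℂ (H →L[ℂ] H) μ).IsFredholm ↔ μ ∈ spectrum ℂ T → μ ∈ opE₀ T := by
  refine ⟨mem_opE₀_of_isFredholm_sub hT, fun h => ?_⟩
  by_cases hμ : μ ∈ spectrum ℂ T
  · exact isFredholm_sub_of_mem_opE₀ hT (h hμ)
  · rw [notMem_spectrum_iff_isUnit_sub, ContinuousLinearMap.isUnit_iff_bijective] at hμ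
    have hk : (T - algebraMap ℂ (H →L[ℂ] H) μ).ker = ⊥ := LinearMap.ker_eq_bot.2 hμ.1
    have hr : (T - algebraMap ℂ (H →L[ℂ] H) μ).range = ⊤ := LinearMap.range_eq_top.2 hμ.2
    rw [isFredholm_iff, hk, hr]
    exact ⟨inferInstance, inferInstance⟩

/-! ### From operators to families -/

/-- The spectrum of a family is the union of the spectra of its members. -/
theorem mem_spectrum_iff_exists (T : C(X, H →L[ℂ] H)) (μ : ℂ) :
    μ ∈ spectrum ℂ T ↔ ∃ x, μ ∈ spectrum ℂ (T x) := by
  -- Inversion is continuous on units, so a pointwise invertible continuous family is invertible in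
  -- the algebra.
  simp only [spectrum.mem_iff, ContinuousMap.isUnit_iff_forall_isUnit, not_forall]
  rfl

theorem isWeylFamily_iff {T : C(X, H →L[ℂ] H)} (hT : IsNormalFamily T) :
    IsWeylFamily T ↔ IsFredholmFamily T := by
  refine ⟨fun h => h.1, fun h => ⟨h, funext fun c => ?_⟩⟩
  induction c using Quotient.inductionOn with
  | h x => exact opIndex_eq_zero (hT x) (h x)

theorem mem_weylSpectrum_iff {T : C(X, H →L[ℂ] H)} (hT : IsNormalFamily T) (μ : ℂ) :
    μ ∈ weylSpectrum T ↔ ∃ x, μ ∈ spectrum ℂ (T x) ∧ μ ∉ opE₀ (T x) := by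
  have hS : IsNormalFamily (T - algebraMap ℂ C(X, H →L[ℂ] H) μ) := fun x =>
    isStarNormal_sub_algebraMap (hT x) μ
  have h : IsFredholmFamily (T - algebraMap ℂ C(X, H →L[ℂ] H) μ) ↔
      ∀ x, μ ∈ spectrum ℂ (T x) → μ ∈ opE₀ (T x) :=
    forall_congr' fun x => isFredholm_sub_iff (hT x) μ
  rw [weylSpectrum, Set.mem_ofPred_eq, isWeylFamily_iff hS, h]
  push Not
  rfl

/-- The set `A` is forced: since `E₀(T x) ⊆ σ(T x)`, it must be the set of `x` with `μ ∈ σ(T x)`,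
which is nonempty when `μ ∈ σ(T)`. -/
theorem mem_familyE₀_iff (T : C(X, H →L[ℂ] H)) (μ : ℂ) :
    μ ∈ familyE₀ T ↔
      μ ∈ spectrum ℂ T ∧ ∀ x, μ ∈ spectrum ℂ (T x) → μ ∈ opE₀ (T x) := by
  refine and_congr_right fun hμ => ⟨?_, fun h => ?_⟩
  · rintro ⟨A, -, hA, hA'⟩ x hx
    by_contra hE
    have hxA : x ∈ Aᶜ := fun hxA => hE (Set.mem_iInter₂.1 hA x hxA)
    exact hA' (Set.mem_iUnion₂.2 ⟨x, hxA, hx⟩)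
  · refine ⟨{x | μ ∈ spectrum ℂ (T x)}, (mem_spectrum_iff_exists T μ).1 hμ,
      Set.mem_iInter₂.2 h, fun hmem => ?_⟩
    obtain ⟨x, hx, hx'⟩ := Set.mem_iUnion₂.1 hmem
    exact hx hx'

end FredholmFamily

theorem mainTheorem10 {X : Type*} [TopologicalSpace X]
    {H : Type*} [NormedAddCommGroup H] [InnerProductSpace ℂ H] [CompleteSpace H]
    (T : C(X, H →L[ℂ] H)) (hT : FredholmFamily.IsNormalFamily T) :
    FredholmFamily.SatisfiesWeylTheorem T := by
  ext μ
  rw [FredholmFamily.mem_weylSpectrum_iff hT, Set.mem_sdiff, FredholmFamily.mem_familyE₀_iff]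
  constructor
  · rintro ⟨x, hx, hE⟩
    exact ⟨(FredholmFamily.mem_spectrum_iff_exists T μ).2 ⟨x, hx⟩, fun h => hE (h.2 x hx)⟩
  · rintro ⟨hμ, h⟩
    by_contra! hne
    exact h ⟨hμ, hne⟩
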